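/- Let $0<\beta\le 1$, $\lambda>0$ and $0<p<1$. For $a,b,\gamma>0$ and $x\in\mathbb R$ let $$E_{a,b}^{\gamma}(x)=\frac1{\Gamma(\gamma)}\sum_{j=0}^{\infty}\frac{\Gamma(j+\gamma)\,x^{j}}{j!\,\Gamma(ja+b)},\qquad E_{a,b}(x)=E_{a,b}^{1}(x),$$ be the Mittag-Leffler functions, and let $\frac{d^{\beta}}{dt^{\beta}}$ be the Caputo derivative: $\frac{d^{\beta}}{dt^{\beta}}f(t)=\frac{1}{\Gamma(1-\beta)}\int_0^t (t-s)^{-\beta}f'(s)\,ds$ if $0<\beta<1$, and $\frac{d^{\beta}}{dt^{\beta}}f(t)=f'(t)$ if $\beta=1$. Let $\{\hat{\mathcal M}_\beta(t)\}_{t\ge 0}$ be a fractional Poisson-logarithmic process, that is, a stochastic process with values in $\{0,1,2,\dots\}$ whose state probabilities $\hat q_\beta(n,t)=\Pr\{\hat{\mathcal M}_\beta(t)=n\}$ are absolutely continuous in $t$ on every interval $[0,T]$, have the initial values $\hat q_\beta(0,0)=1$ and $\hat q_\beta(n,0)=0$ for $n\ge 1$, and satisfy, for almost every $t>0$, $$\frac{d^{\beta}}{dt^{\beta}}\hat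 q_\beta(0,t)=-\lambda\hat q_\beta(0,t),$$ $$\frac{d^{\beta}}{dt^{\beta}}\hat q_\beta(n,t)=-\lambda\hat q_\beta(n,t)-\frac{\lambda}{\ln p}\sum_{j=1}^{n}\frac{(1-p)^{j}}{j}\,\hat q_\beta(n-j,t),\quad n\ge 1.$$ Then, for every $t\ge 0$, $$\hat q_\beta(0,t)=E_{\beta,1}(-\lambda t^{\beta}),$$ and, for every $n\ge 1$, $$\hat q_\beta(n,t)=\sum_{(x_1,\dots,x_n)\in\Omega_n}\left(\prod_{j=1}^{n}\frac{\left((1-p)^{j}/j\right)^{x_j}}{x_j!}\right) z_n!\left(\frac{-\lambda t^{\beta}}{\ln p}\right)^{z_n}E_{\beta,\,z_n\beta+1}^{\,z_n+1}\left(-\lambda t^{\beta}\right),$$ where $z_n=x_1+\dots+x_n$ and $\Omega_n=\{(x_1,\dots,x_n): x_j\in\{0,1,2,\dots\},\ \sum_{j=1}^{n}j\,x_j=n\}$. -/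

import Mathlib

open MeasureTheory
open scoped NNReal Nat

noncomputable section

/-- The three-parameter Mittag-Leffler function
`E_{α,β}^γ(x) = (1/Γ(γ)) ∑_{j ≥ 0} Γ(j+γ) x^j / (j! Γ(jα+β))`, for `α, β, γ > 0`. -/
def mittagLeffler3 (α β γ x : ℝ) : ℝ :=
  1 / Real.Gamma γ *
    ∑' j : ℕ, Real.Gamma (j + γ) * x ^ j / ((j ! : ℝ) * Real.Gamma (j * α + β))

/-- The two-parameter Mittag-Leffler function `E_{α,β} = E_{α,β}^1`. -/
def mittagLeffler2 (α β x : ℝ) : ℝ := mittagLeffler3 α β 1 x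

/-- The Caputo fractional derivative of order `β`, `0 < β ≤ 1`, of `f` at `t`. -/
def caputoDeriv (β : ℝ) (f : ℝ → ℝ) (t : ℝ) : ℝ :=
  if β = 1 then deriv f t
  else 1 / Real.Gamma (1 - β) * ∫ s in (0 : ℝ)..t, (t - s) ^ (-β) * deriv f s

/-- The state probability `Pr {M(t) = n}` as a function of real time
(only `t ≥ 0` is meaningful). -/
def stateProb {Ω : Type*} [MeasurableSpace Ω] (μ : Measure Ω) (M : ℝ≥0 → Ω → ℕ)
    (n : ℕ) (t : ℝ) : ℝ :=
  μ.real {ω | M t.toNNReal ω = n}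

/-- `M` is a fractional Poisson-logarithmic process with parameters `β`, `lam`, `p`: a process
with values in `ℕ` whose state probabilities are absolutely continuous on bounded time intervals
(so that their Caputo derivatives make sense almost everywhere) and satisfy, for almost every
`t > 0`, the governing system of fractional differential equations, with `M(0) = 0` almost surely
as initial condition. -/
structure IsFracPoissonLog {Ω : Type*} [MeasurableSpace Ω] (μ : Measure Ω) (β lam p : ℝ)
    (M : ℝ≥0 → Ω → ℕ) : Prop where
  measurable : ∀ t, Measurable (M t)
  absCont : ∀ n : ℕ, ∀ T : ℝ, 0 < T → AbsolutelyContinuousOnInterval (stateProb μ M n) 0 T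
  init_zero : stateProb μ M 0 0 = 1
  init_pos : ∀ n : ℕ, 1 ≤ n → stateProb μ M n 0 = 0
  eqn_zero : ∀ᵐ t ∂(volume.restrict (Set.Ioi (0 : ℝ))),
    caputoDeriv β (stateProb μ M 0) t = -lam * stateProb μ M 0 t
  eqn_pos : ∀ n : ℕ, 1 ≤ n → ∀ᵐ t ∂(volume.restrict (Set.Ioi (0 : ℝ))),
    caputoDeriv β (stateProb μ M n) t =
      -lam * stateProb μ M n t -
        lam / Real.log p *
          ∑ j ∈ Finset.Icc 1 n, (1 - p) ^ j / (j : ℝ) * stateProb μ M (n - j) t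

/-- The finite set `Ω_n` of tuples `(x_1, …, x_n)` of natural numbers with
`∑_{j=1}^n j x_j = n`. The coordinate `x_j` is stored at the index `j - 1` of `Fin n`; the bound
`x_j ≤ n`, which makes the set visibly finite, is automatic (see `mem_weightedTuples`). -/
def weightedTuples (n : ℕ) : Finset (Fin n → ℕ) :=
  (Fintype.piFinset fun _ : Fin n => Finset.range (n + 1)).filter
    fun x => ∑ j : Fin n, ((j : ℕ) + 1) * x j = n

theorem mem_weightedTuples (n : ℕ) (x : Fin n → ℕ) :
    x ∈ weightedTuples n ↔ ∑ j : Fin n, ((j : ℕ) + 1) * x j = n := by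
  simp only [weightedTuples, Finset.mem_filter, Fintype.mem_piFinset, Finset.mem_range,
    and_iff_right_iff_imp]
  intro h i
  have h1 : ((i : ℕ) + 1) * x i ≤ ∑ j : Fin n, ((j : ℕ) + 1) * x j :=
    Finset.single_le_sum (f := fun j : Fin n => ((j : ℕ) + 1) * x j)
      (fun _ _ => Nat.zero_le _) (Finset.mem_univ i)
  nlinarith [Nat.zero_le ((i : ℕ) * x i)]

end

/-! Write I^a for the fractional integral of order a, and collect the rates in P(X) = -λ + ∑ b_j
X^(j+1), so that the governing system says that the Caputo derivative of q_m is ∑ [X^i]P · q_(m-i).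
The Caputo derivative is I^(1-β) applied to f', so by the semigroup law I^β turns the system into a
Volterra system (`IsFracPoissonLog.volterra`). Iterating it N times (`volterra_iterate`) expresses
q_n as ∑_{k<N} [X^n]P^k · t^(kβ)/Γ(kβ+1) plus a remainder made of the I^(Nβ) q_m. Since |q_m| ≤ 1,
the remainder is O((B t^β)^N / Γ(Nβ+1)), which tends to 0 (`tendsto_volterra`). Hence q_n(t) is the
n-th coefficient in X of E_{β,1}(P(X) t^β), and uniqueness needs no separate argument. Expanding P^k
by the binomial and multinomial theorems (`coeff_pow_eq_sum_weightedTuples`) and summing over k for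
each tuple (`hasSum_mittagLeffler3`) gives the formula. -/

/-! ### Riemann–Liouville integrals. -/

/-- The Riemann–Liouville fractional integral of order `a > 0`, based at `0`. -/
noncomputable def riemannLiouville (a : ℝ) (f : ℝ → ℝ) (t : ℝ) : ℝ :=
  (Real.Gamma a)⁻¹ * ∫ s in (0 : ℝ)..t, (t - s) ^ (a - 1) * f s

theorem integral_rpow_mul_sub_rpow {a b : ℝ} (ha : 0 < a) (hb : 0 < b) {t : ℝ} (ht : 0 < t) :
    ∫ x in (0 : ℝ)..t, x ^ (b - 1) * (t - x) ^ (a - 1) =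
      t ^ (a + b - 1) * (Real.Gamma a * Real.Gamma b / Real.Gamma (a + b)) := by
  have h := Complex.betaIntegral_scaled (b : ℂ) (a : ℂ) ht
  rw [Complex.betaIntegral_eq_Gamma_mul_div _ _ (by simpa) (by simpa)] at h
  have h2 : ∫ x in (0 : ℝ)..t, (x : ℂ) ^ ((b : ℂ) - 1) * ((t : ℂ) - x) ^ ((a : ℂ) - 1) =
      ∫ x in (0 : ℝ)..t, ((x ^ (b - 1) * (t - x) ^ (a - 1) : ℝ) : ℂ) := by
    refine intervalIntegral.integral_congr fun x hx => ?_
    rw [Set.uIcc_of_le ht.le] at hx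
    rw [Complex.ofReal_mul, Complex.ofReal_cpow hx.1, Complex.ofReal_cpow (by linarith [hx.2])]
    push_cast
    rfl
  rw [h2, intervalIntegral.integral_ofReal] at h
  apply Complex.ofReal_injective
  rw [h, Complex.ofReal_mul, Complex.ofReal_cpow ht.le]
  push_cast
  rw [← Complex.Gamma_ofReal, ← Complex.Gamma_ofReal, ← Complex.Gamma_ofReal]
  push_cast
  rw [add_comm (b : ℂ), mul_comm (Complex.Gamma (b : ℂ))]

theorem integral_sub_rpow_mul_sub_rpow {a b : ℝ} (ha : 0 < a) (hb : 0 < b) {r t : ℝ}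
    (hrt : r < t) :
    ∫ s in r..t, (t - s) ^ (a - 1) * (s - r) ^ (b - 1) =
      (t - r) ^ (a + b - 1) * (Real.Gamma a * Real.Gamma b / Real.Gamma (a + b)) := by
  rw [← integral_rpow_mul_sub_rpow ha hb (sub_pos.2 hrt)]
  have := intervalIntegral.integral_comp_sub_right
    (fun x => x ^ (b - 1) * (t - r - x) ^ (a - 1)) r (a := r) (b := t)
  rw [sub_self] at this
  rw [← this]
  refine intervalIntegral.integral_congr fun x _ => ?_
  rw [mul_comm, show t - r - (x - r) = t - x by ring]

theorem intervalIntegrable_sub_rpow_mul_sub_rpow {a b : ℝ} (ha : 0 < a) (hb : 0 < b) {r t : ℝ}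
    (hrt : r < t) :
    IntervalIntegrable (fun s => (t - s) ^ (a - 1) * (s - r) ^ (b - 1)) volume r t := by
  -- The integral of a non-integrable function is 0 by convention, so the positive Beta value forces
  -- integrability.
  apply intervalIntegral.intervalIntegrable_of_integral_ne_zero
  rw [integral_sub_rpow_mul_sub_rpow ha hb hrt]
  have := Real.rpow_pos_of_pos (sub_pos.2 hrt) (a + b - 1)
  have := Real.Gamma_pos_of_pos ha
  have := Real.Gamma_pos_of_pos hb
  have := Real.Gamma_pos_of_pos (add_pos ha hb)
  positivity

theorem intervalIntegrable_sub_rpow {a : ℝ} (ha : 0 < a) {t : ℝ} :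
    IntervalIntegrable (fun s => (t - s) ^ (a - 1)) volume 0 t := by
  have := (intervalIntegral.intervalIntegrable_rpow' (r := a - 1) (by linarith)
    (a := t) (b := 0)).comp_sub_left t
  simpa using this

/-- The semigroup property of the Riemann–Liouville integrals. -/
theorem riemannLiouville_comp {a b t : ℝ} {f : ℝ → ℝ} (ha : 0 < a) (hb : 0 < b)
    (hab : 1 ≤ a + b) (ht : 0 ≤ t) (hf : IntervalIntegrable f volume 0 t) :
    riemannLiouville a (riemannLiouville b f) t = riemannLiouville (a + b) f t := by
  -- As a + b ≥ 1, the composed kernel is continuous, so integrability of f suffices at every t, not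
  -- just almost every t.
  have hfk : IntervalIntegrable (fun r => (t - r) ^ (a + b - 1) * f r) volume 0 t := by
    refine hf.continuousOn_mul (Continuous.continuousOn ?_)
    exact (continuous_const.sub continuous_id).rpow_const fun _ => Or.inr (by linarith)
  set ν : Measure ℝ := volume.restrict (Set.Ioc 0 t) with hν
  -- The integrand on the triangle r ≤ s, extended by 0 to the square so that Fubini applies to a
  -- product measure.
  set F : ℝ → ℝ → ℝ := fun r s =>
    if r ≤ s then (t - s) ^ (a - 1) * ((s - r) ^ (b - 1) * f r) else 0 with hF
  have hΓa := Real.Gamma_pos_of_pos ha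
  have hΓb := Real.Gamma_pos_of_pos hb
  have hΓab := Real.Gamma_pos_of_pos (add_pos ha hb)
  set K : ℝ := Real.Gamma a * Real.Gamma b / Real.Gamma (a + b) with hK
  have hint1 (g : ℝ → ℝ) (r : ℝ) (hr : r ∈ Set.Ioo 0 t) :
      ∫ s, (if r ≤ s then g s else 0) ∂ν = ∫ s in r..t, g s := by
    have : (fun s => if r ≤ s then g s else 0) = (Set.Ici r).indicator g := by
      ext s; simp [Set.indicator]
    rw [this, integral_indicator measurableSet_Ici, hν, Measure.restrict_restrict measurableSet_Ici,
      intervalIntegral.integral_of_le hr.2.le, ← integral_Icc_eq_integral_Ioc]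
    congr 2
    ext s
    simp only [Set.mem_inter_iff, Set.mem_Ici, Set.mem_Ioc, Set.mem_Icc]
    exact ⟨fun h => ⟨h.1, h.2.2⟩, fun h => ⟨h.1, by linarith [hr.1, h.1], h.2⟩⟩
  have hint2 (g : ℝ → ℝ) (s : ℝ) (hs : s ∈ Set.Ioc 0 t) :
      ∫ r, (if r ≤ s then g r else 0) ∂ν = ∫ r in (0 : ℝ)..s, g r := by
    have : (fun r => if r ≤ s then g r else 0) = (Set.Iic s).indicator g := by
      ext r; simp [Set.indicator]
    rw [this, integral_indicator measurableSet_Iic, hν, Measure.restrict_restrict measurableSet_Iic,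
      intervalIntegral.integral_of_le hs.1.le]
    congr 2
    ext r
    simp only [Set.mem_inter_iff, Set.mem_Iic, Set.mem_Ioc]
    exact ⟨fun h => ⟨h.2.1, h.1⟩, fun h => ⟨h.2, h.1, h.2.trans hs.2⟩⟩
  have hae : ∀ᵐ r ∂ν, r ∈ Set.Ioo 0 t := by
    rw [hν, ← restrict_Ioo_eq_restrict_Ioc]
    exact ae_restrict_mem measurableSet_Ioo
  have hmem : ∀ᵐ r ∂ν, r ∈ Set.Ioc 0 t := ae_restrict_mem measurableSet_Ioc
  have hfν : AEStronglyMeasurable f ν := hf.1.aestronglyMeasurable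
  have hmeas : AEStronglyMeasurable (Function.uncurry F) (ν.prod ν) := by
    have h1 : AEStronglyMeasurable (fun z : ℝ × ℝ =>
        (t - z.2) ^ (a - 1) * ((z.2 - z.1) ^ (b - 1) * f z.1)) (ν.prod ν) := by
      refine AEStronglyMeasurable.mul ?_ (AEStronglyMeasurable.mul ?_ hfν.comp_fst)
      · exact Measurable.aestronglyMeasurable (by fun_prop)
      · exact Measurable.aestronglyMeasurable (by fun_prop)
    have h2 := h1.indicator (measurableSet_le measurable_fst measurable_snd :
      MeasurableSet {z : ℝ × ℝ | z.1 ≤ z.2})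
    refine h2.congr (Filter.Eventually.of_forall fun z => ?_)
    simp [Function.uncurry, hF, Set.indicator]
  -- The free constant c serves twice: as ‖f r‖ for integrability on the square, and as f r for the
  -- value.
  have hsec (r : ℝ) (hr : r ∈ Set.Ioo 0 t) (c : ℝ) :
      ∫ s, (if r ≤ s then (t - s) ^ (a - 1) * ((s - r) ^ (b - 1) * c) else 0) ∂ν =
        K * ((t - r) ^ (a + b - 1) * c) := by
    rw [hint1 (fun s => (t - s) ^ (a - 1) * ((s - r) ^ (b - 1) * c)) r hr]
    simp_rw [← mul_assoc]
    rw [intervalIntegral.integral_mul_const, integral_sub_rpow_mul_sub_rpow ha hb hr.2]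
    ring
  have hprod : Integrable (Function.uncurry F) (ν.prod ν) := by
    rw [integrable_prod_iff hmeas]
    constructor
    · filter_upwards [hae] with r hr
      have h1 := ((intervalIntegrable_sub_rpow_mul_sub_rpow ha hb hr.2).mul_const (f r))
      rw [intervalIntegrable_iff_integrableOn_Icc_of_le hr.2.le] at h1
      have h2 := h1.integrable_indicator measurableSet_Icc
      refine (h2.mono_measure (Measure.restrict_le_self (s := Set.Ioc 0 t))).congr ?_
      filter_upwards [hmem] with s hs
      simp only [Function.uncurry, hF, Set.indicator, Set.mem_Icc, hs.2, and_true]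
      split_ifs <;> ring
    · have h1 : Integrable (fun r => K * ‖(t - r) ^ (a + b - 1) * f r‖) ν :=
        (hfk.1.norm.const_mul K)
      refine h1.congr ?_
      filter_upwards [hae] with r hr
      have : ∀ᵐ s ∂ν, ‖Function.uncurry F (r, s)‖ =
          if r ≤ s then (t - s) ^ (a - 1) * ((s - r) ^ (b - 1) * ‖f r‖) else 0 := by
        filter_upwards [hmem] with s hs
        simp only [Function.uncurry, hF]
        split_ifs with h
        · rw [norm_mul, norm_mul, Real.norm_of_nonneg (Real.rpow_nonneg (by linarith [hs.2]) _),
            Real.norm_of_nonneg (Real.rpow_nonneg (by linarith) _)]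
        · simp
      rw [integral_congr_ae this, hsec r hr, norm_mul,
        Real.norm_of_nonneg (Real.rpow_nonneg (by linarith [hr.2]) _)]
  have hswap := integral_integral_swap hprod
  have hL : ∫ s, ∫ r, F r s ∂ν ∂ν =
      ∫ s in (0 : ℝ)..t, (t - s) ^ (a - 1) * ∫ r in (0 : ℝ)..s, (s - r) ^ (b - 1) * f r := by
    rw [intervalIntegral.integral_of_le ht]
    refine integral_congr_ae ?_
    filter_upwards [hmem] with s hs
    rw [hint2 (fun r => (t - s) ^ (a - 1) * ((s - r) ^ (b - 1) * f r)) s hs,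
      intervalIntegral.integral_const_mul]
  have hR : ∫ r, ∫ s, F r s ∂ν ∂ν = K * ∫ r in (0 : ℝ)..t, (t - r) ^ (a + b - 1) * f r := by
    rw [intervalIntegral.integral_of_le ht, ← integral_const_mul]
    refine integral_congr_ae ?_
    filter_upwards [hae] with r hr
    exact hsec r hr (f r)
  rw [hL, hR] at hswap
  have hpull : ∫ s in (0 : ℝ)..t, (t - s) ^ (a - 1) * riemannLiouville b f s =
      (Real.Gamma b)⁻¹ *
        ∫ s in (0 : ℝ)..t, (t - s) ^ (a - 1) * ∫ r in (0 : ℝ)..s, (s - r) ^ (b - 1) * f r := by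
    rw [← intervalIntegral.integral_const_mul]
    refine intervalIntegral.integral_congr fun s _ => ?_
    simp only [riemannLiouville]
    ring
  rw [riemannLiouville, hpull, ← hswap, riemannLiouville, hK]
  field_simp

theorem riemannLiouville_congr_ae {a t : ℝ} {f g : ℝ → ℝ} (ht : 0 ≤ t)
    (h : ∀ᵐ s ∂(volume.restrict (Set.Ioc 0 t)), f s = g s) :
    riemannLiouville a f t = riemannLiouville a g t := by
  rw [riemannLiouville, riemannLiouville, intervalIntegral.integral_of_le ht,
    intervalIntegral.integral_of_le ht]
  congr 1
  refine integral_congr_ae ?_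
  filter_upwards [h] with s hs
  rw [hs]

theorem riemannLiouville_const {a t : ℝ} (ha : 0 < a) (c : ℝ) :
    riemannLiouville a (fun _ => c) t = c * (t ^ a / Real.Gamma (a + 1)) := by
  have h := intervalIntegral.integral_comp_sub_left (fun x : ℝ => x ^ (a - 1)) t
    (a := 0) (b := t)
  rw [riemannLiouville, intervalIntegral.integral_mul_const, h, sub_self, sub_zero,
    integral_rpow (Or.inl (by linarith)), Real.Gamma_add_one ha.ne', sub_add_cancel,
    Real.zero_rpow ha.ne', sub_zero]
  have := Real.Gamma_pos_of_pos ha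
  field_simp

theorem intervalIntegrable_kernel_mul {a t : ℝ} {f : ℝ → ℝ} (ha : 0 < a) (ht : 0 ≤ t)
    (hf : ContinuousOn f (Set.Icc 0 t)) :
    IntervalIntegrable (fun s => (t - s) ^ (a - 1) * f s) volume 0 t :=
  (intervalIntegrable_sub_rpow ha).mul_continuousOn (by rwa [Set.uIcc_of_le ht])

theorem riemannLiouville_sub {a t : ℝ} {f g : ℝ → ℝ} (ha : 0 < a) (ht : 0 ≤ t)
    (hf : ContinuousOn f (Set.Icc 0 t)) (hg : ContinuousOn g (Set.Icc 0 t)) :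
    riemannLiouville a (fun s => f s - g s) t =
      riemannLiouville a f t - riemannLiouville a g t := by
  simp only [riemannLiouville]
  rw [← mul_sub, ← intervalIntegral.integral_sub (intervalIntegrable_kernel_mul ha ht hf)
    (intervalIntegrable_kernel_mul ha ht hg)]
  simp_rw [mul_sub]

theorem riemannLiouville_sum {ι : Type*} {a t : ℝ} (S : Finset ι) (c : ι → ℝ) (f : ι → ℝ → ℝ)
    (ha : 0 < a) (ht : 0 ≤ t) (hf : ∀ i ∈ S, ContinuousOn (f i) (Set.Icc 0 t)) :
    riemannLiouville a (fun s => ∑ i ∈ S, c i * f i s) t =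
      ∑ i ∈ S, c i * riemannLiouville a (f i) t := by
  simp only [riemannLiouville]
  have : ∀ s, (t - s) ^ (a - 1) * ∑ i ∈ S, c i * f i s =
      ∑ i ∈ S, c i * ((t - s) ^ (a - 1) * f i s) := fun s => by
    rw [Finset.mul_sum]
    exact Finset.sum_congr rfl fun i _ => by ring
  simp_rw [this]
  rw [intervalIntegral.integral_finsetSum fun i hi =>
    (intervalIntegrable_kernel_mul ha ht (hf i hi)).const_mul _, Finset.mul_sum]
  refine Finset.sum_congr rfl fun i _ => ?_
  rw [intervalIntegral.integral_const_mul]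
  ring

theorem abs_riemannLiouville_le {a t : ℝ} {f : ℝ → ℝ} (ha : 0 < a) (ht : 0 ≤ t)
    (hf1 : ∀ s, |f s| ≤ 1) :
    |riemannLiouville a f t| ≤ t ^ a / Real.Gamma (a + 1) := by
  have hΓ := Real.Gamma_pos_of_pos ha
  rw [← one_mul (t ^ a / Real.Gamma (a + 1)), ← riemannLiouville_const ha 1, riemannLiouville,
    riemannLiouville, abs_mul, abs_of_pos (inv_pos.2 hΓ)]
  refine mul_le_mul_of_nonneg_left ?_ (inv_pos.2 hΓ).le
  rw [← Real.norm_eq_abs]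
  refine intervalIntegral.norm_integral_le_of_norm_le ht ?_ ?_
  · refine Filter.Eventually.of_forall fun s hs => ?_
    have h0 : 0 ≤ (t - s) ^ (a - 1) := Real.rpow_nonneg (by linarith [hs.2]) _
    rw [norm_mul, Real.norm_of_nonneg h0]
    rw [Real.norm_eq_abs]
    exact mul_le_mul_of_nonneg_left (hf1 s) h0
  · exact intervalIntegrable_kernel_mul ha ht continuousOn_const

theorem riemannLiouville_one (f : ℝ → ℝ) (t : ℝ) :
    riemannLiouville 1 f t = ∫ s in (0 : ℝ)..t, f s := by
  simp [riemannLiouville]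

/-! ### Fractional integration of Caputo derivatives. -/

/-- Fractional integrals of Caputo derivatives, before the last integration is carried out. -/
theorem riemannLiouville_caputoDeriv_aux {β b t : ℝ} {f : ℝ → ℝ} (hβ0 : 0 < β) (hβ1 : β ≤ 1)
    (hb : 0 ≤ b) (ht : 0 ≤ t) (hf : IntervalIntegrable (deriv f) volume 0 t) :
    riemannLiouville (b + β) (caputoDeriv β f) t = riemannLiouville (b + 1) (deriv f) t := by
  rcases hβ1.eq_or_lt with rfl | hβ
  · congr 1
    ext s
    simp [caputoDeriv]
  · have : caputoDeriv β f = riemannLiouville (1 - β) (deriv f) := by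
      ext s
      rw [caputoDeriv, if_neg hβ.ne, riemannLiouville, one_div, show 1 - β - 1 = -β by ring]
    -- The orders b + β and 1 - β add up to b + 1 ≥ 1.
    rw [this, riemannLiouville_comp (by linarith) (by linarith) (by linarith) ht hf]
    congr 1
    ring

theorem riemannLiouville_caputoDeriv {β t : ℝ} {f : ℝ → ℝ} (hβ0 : 0 < β) (hβ1 : β ≤ 1)
    (ht : 0 ≤ t) (hf : AbsolutelyContinuousOnInterval f 0 t) :
    riemannLiouville β (caputoDeriv β f) t = f t - f 0 := by
  have h := riemannLiouville_caputoDeriv_aux hβ0 hβ1 le_rfl ht hf.intervalIntegrable_deriv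
  rwa [zero_add, zero_add, riemannLiouville_one, hf.integral_deriv_eq_sub] at h

/-- Both sides are I^b of I^1 f' = f - f(0); the constant f(0) produces the power of t. -/
theorem riemannLiouville_add_caputoDeriv {β b t : ℝ} {f : ℝ → ℝ} (hβ0 : 0 < β) (hβ1 : β ≤ 1)
    (hb : 0 < b) (ht : 0 ≤ t) (hf : AbsolutelyContinuousOnInterval f 0 t) :
    riemannLiouville (b + β) (caputoDeriv β f) t =
      riemannLiouville b f t - f 0 * (t ^ b / Real.Gamma (b + 1)) := by
  rw [riemannLiouville_caputoDeriv_aux hβ0 hβ1 hb.le ht hf.intervalIntegrable_deriv,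
    ← riemannLiouville_comp hb one_pos (by linarith) ht hf.intervalIntegrable_deriv,
    ← riemannLiouville_const hb,
    ← riemannLiouville_sub hb ht (by simpa [Set.uIcc_of_le ht] using hf.continuousOn)
      continuousOn_const]
  refine riemannLiouville_congr_ae ht ?_
  filter_upwards [ae_restrict_mem measurableSet_Ioc] with s hs
  rw [riemannLiouville_one]
  refine AbsolutelyContinuousOnInterval.integral_deriv_eq_sub (hf.mono ?_)
  rw [Set.uIcc_of_le hs.1.le, Set.uIcc_of_le ht]
  exact Set.Icc_subset_Icc_right hs.2

/-! ### Growth of the Gamma function. -/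

/-- Keep only the part s > x of the Gamma integral, where s^(y-1) ≥ x^(y-1). -/
theorem exp_neg_mul_rpow_le_Gamma {x y : ℝ} (hx : 0 < x) (hy : 1 ≤ y) :
    Real.exp (-x) * x ^ (y - 1) ≤ Real.Gamma y := by
  rw [Real.Gamma_eq_integral (by linarith), ← integral_exp_neg_Ioi, ← integral_mul_const]
  have hint := Real.GammaIntegral_convergent (s := y) (by linarith)
  calc ∫ s in Set.Ioi x, Real.exp (-s) * x ^ (y - 1)
      ≤ ∫ s in Set.Ioi x, Real.exp (-s) * s ^ (y - 1) := by
        refine setIntegral_mono_on ((integrableOn_exp_neg_Ioi x).mul_const _)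
          (hint.mono_set (Set.Ioi_subset_Ioi hx.le)) measurableSet_Ioi fun s hs => ?_
        exact mul_le_mul_of_nonneg_left
          (Real.rpow_le_rpow hx.le (le_of_lt hs) (by linarith)) (Real.exp_pos _).le
    _ ≤ ∫ s in Set.Ioi 0, Real.exp (-s) * s ^ (y - 1) := by
        refine setIntegral_mono_set hint ?_ (Set.Ioi_subset_Ioi hx.le).eventuallyLE
        filter_upwards [ae_restrict_mem measurableSet_Ioi] with s hs
        exact mul_nonneg (Real.exp_pos _).le (Real.rpow_nonneg (le_of_lt hs) _)

theorem summable_pow_div_Gamma {β : ℝ} (hβ : 0 < β) {C : ℝ} (hC : 0 ≤ C) :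
    Summable fun k : ℕ => C ^ k / Real.Gamma (k * β + 1) := by
  -- Chosen so that x^β = 2(C + 1): the Gamma bound then dominates the series by a geometric one of
  -- ratio 1/2.
  set x : ℝ := (2 * (C + 1)) ^ β⁻¹ with hx
  have hx0 : 0 < x := by positivity
  have hxβ : x ^ β = 2 * (C + 1) := by
    rw [hx, ← Real.rpow_mul (by positivity), inv_mul_cancel₀ hβ.ne', Real.rpow_one]
  refine Summable.of_nonneg_of_le (fun k => ?_) (fun k => ?_)
    (summable_geometric_two.mul_left (Real.exp x))
  · have := Real.Gamma_pos_of_pos (show 0 < k * β + 1 by positivity)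
    positivity
  · have h := exp_neg_mul_rpow_le_Gamma hx0 (show 1 ≤ (k : ℝ) * β + 1 by
      have : 0 ≤ (k : ℝ) * β := by positivity
      linarith)
    rw [add_sub_cancel_right, mul_comm (k : ℝ), Real.rpow_mul hx0.le, hxβ, Real.rpow_natCast,
      mul_pow, Real.exp_neg] at h
    have hpos : 0 < (Real.exp x)⁻¹ * (2 ^ k * (C + 1) ^ k) := by positivity
    calc C ^ k / Real.Gamma (k * β + 1)
        ≤ C ^ k / ((Real.exp x)⁻¹ * (2 ^ k * (C + 1) ^ k)) := by
          have h' : (Real.exp x)⁻¹ * (2 ^ k * (C + 1) ^ k) ≤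
            Real.Gamma (k * β + 1) := by
            rwa [mul_comm (k : ℝ)]
          gcongr
      _ ≤ (C + 1) ^ k / ((Real.exp x)⁻¹ * (2 ^ k * (C + 1) ^ k)) := by
          gcongr
          linarith
      _ = Real.exp x * (1 / 2) ^ k := by
          rw [div_pow, one_pow]
          field_simp

/-! ### Coefficients of powers of the generating polynomial. -/

/-- The polynomial `l + b₀ X + b₁ X² + ⋯ + bₙ₋₁ Xⁿ`. -/
noncomputable def generatingPoly (l : ℝ) (b : ℕ → ℝ) (n : ℕ) : Polynomial ℝ :=
  Polynomial.C l + ∑ j : Fin n, Polynomial.C (b j) * Polynomial.X ^ ((j : ℕ) + 1)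

theorem coeff_generatingPoly (l : ℝ) (b : ℕ → ℝ) {n i : ℕ} (hi : i ≤ n) :
    (generatingPoly l b n).coeff i = if i = 0 then l else b (i - 1) := by
  have h := Fin.sum_univ_eq_sum_range
    (fun j => (Polynomial.C (b j) * Polynomial.X ^ (j + 1)).coeff i) n
  rw [generatingPoly, Polynomial.coeff_add, Polynomial.finsetSum_coeff, h]
  simp only [Polynomial.coeff_C_mul, Polynomial.coeff_X_pow, Polynomial.coeff_C]
  rcases i with _ | i
  · simp
  · simp [show i < n by omega]

/-- The coefficients of a power of a polynomial, as a sum over weighted tuples. -/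
theorem coeff_pow_eq_sum_weightedTuples (l : ℝ) (b : ℕ → ℝ) (n k : ℕ) :
    (generatingPoly l b n ^ k).coeff n =
      ∑ x ∈ weightedTuples n, (∏ j : Fin n, b j ^ x j / ((x j)! : ℝ)) * ((∑ j, x j)! : ℝ) *
        ((k.choose (∑ j, x j) : ℝ) * l ^ (k - ∑ j, x j)) := by
  classical
  set G : (Fin n → ℕ) → ℝ := fun x => (∏ j : Fin n, b j ^ x j / ((x j)! : ℝ)) *
    ((∑ j, x j)! : ℝ) * ((k.choose (∑ j, x j) : ℝ) * l ^ (k - ∑ j, x j)) with hG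
  -- Here z is the exponent of the nonconstant part in the binomial expansion; the multinomial
  -- theorem then ranges over tuples of sum z.
  have hz (z : ℕ) :
      ((∑ j : Fin n, Polynomial.C (b j) * Polynomial.X ^ ((j : ℕ) + 1)) ^ z *
        Polynomial.C l ^ (k - z) * (k.choose z : Polynomial ℝ)).coeff n =
      ∑ x ∈ Finset.piAntidiag Finset.univ z with ∑ j : Fin n, ((j : ℕ) + 1) * x j = n, G x := by
    rw [← Polynomial.C_eq_natCast, ← Polynomial.C_pow, Polynomial.coeff_mul_C,
      Polynomial.coeff_mul_C, Finset.sum_pow_eq_sum_piAntidiag, Polynomial.finsetSum_coeff,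
      Finset.sum_mul, Finset.sum_mul, Finset.sum_filter]
    refine Finset.sum_congr rfl fun x hx => ?_
    have hxz : ∑ j, x j = z := (Finset.mem_piAntidiag.1 hx).1
    simp_rw [mul_pow, ← Polynomial.C_pow, ← pow_mul]
    rw [Finset.prod_mul_distrib, ← map_prod, Finset.prod_pow_eq_pow_sum, ← Polynomial.C_eq_natCast,
      Polynomial.coeff_C_mul, Polynomial.coeff_C_mul, Polynomial.coeff_X_pow]
    have hm : (Nat.multinomial Finset.univ x : ℝ) * ∏ j : Fin n, b j ^ x j =
        (∏ j : Fin n, b j ^ x j / ((x j)! : ℝ)) * ((∑ j, x j)! : ℝ) := by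
      have h1 := Nat.multinomial_spec Finset.univ x
      have h2 : (∏ j, ((x j)! : ℝ)) * (Nat.multinomial Finset.univ x : ℝ) = ((∑ j, x j)! : ℝ) := by
        exact_mod_cast h1
      have h3 : (∏ j, ((x j)! : ℝ)) ≠ 0 :=
        Finset.prod_ne_zero_iff.2 fun j _ => by positivity
      rw [Finset.prod_div_distrib, ← h2]
      field_simp
    by_cases h : ∑ j : Fin n, ((j : ℕ) + 1) * x j = n
    · rw [if_pos h, if_pos h.symm, hG]
      simp only
      rw [← hm, hxz]
      ring
    · rw [if_neg h, if_neg (Ne.symm h)]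
      ring
  rw [generatingPoly, add_comm, add_pow, Polynomial.finsetSum_coeff,
    Finset.sum_congr rfl fun z _ => hz z]
  -- Tuples of sum greater than k contribute nothing, as their binomial coefficient vanishes; the
  -- truncated subtraction in the exponent of l is thus harmless.
  have hfil : ∑ x ∈ weightedTuples n, G x =
      ∑ x ∈ weightedTuples n with ∑ j, x j ∈ Finset.range (k + 1), G x := by
    rw [Finset.sum_filter]
    refine Finset.sum_congr rfl fun x _ => ?_
    split_ifs with h
    · rfl
    · rw [Finset.mem_range, not_lt] at h
      rw [hG]
      simp only
      rw [Nat.choose_eq_zero_of_lt (by omega)]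
      simp
  rw [hfil, ← Finset.sum_fiberwise_of_maps_to (g := fun x : Fin n → ℕ => ∑ j, x j)
    (t := Finset.range (k + 1)) fun x hx => (Finset.mem_filter.1 hx).2]
  refine Finset.sum_congr rfl fun z hz => Finset.sum_congr ?_ fun _ _ => rfl
  ext x
  simp only [Finset.mem_filter, Finset.mem_piAntidiag, mem_weightedTuples]
  constructor
  · rintro ⟨⟨h1, -⟩, h2⟩
    exact ⟨⟨h2, by rwa [h1]⟩, h1⟩
  · rintro ⟨⟨h1, -⟩, h2⟩
    exact ⟨⟨h2, by simp⟩, h1⟩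

/-- The ℓ¹ norm of the coefficients is submultiplicative, and coefficients of index above n never
enter. -/
theorem abs_coeff_pow_le (P : Polynomial ℝ) (n N : ℕ) {i : ℕ} (hi : i ≤ n) :
    |(P ^ N).coeff i| ≤ (∑ j ∈ Finset.range (n + 1), |P.coeff j|) ^ N := by
  induction N generalizing i with
  | zero =>
    rw [pow_zero, pow_zero, Polynomial.coeff_one]
    split_ifs <;> simp
  | succ N ih =>
    set B := ∑ j ∈ Finset.range (n + 1), |P.coeff j|
    have hB : 0 ≤ B := Finset.sum_nonneg fun _ _ => abs_nonneg _
    rw [pow_succ', Polynomial.coeff_mul, Finset.Nat.sum_antidiagonal_eq_sum_range_succ_mk]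
    calc |∑ j ∈ Finset.range i.succ, P.coeff j * (P ^ N).coeff (i - j)|
        ≤ ∑ j ∈ Finset.range i.succ, |P.coeff j * (P ^ N).coeff (i - j)| :=
          Finset.abs_sum_le_sum_abs _ _
      _ ≤ ∑ j ∈ Finset.range i.succ, |P.coeff j| * B ^ N := by
          refine Finset.sum_le_sum fun j _ => ?_
          rw [abs_mul]
          exact mul_le_mul_of_nonneg_left (ih (by omega)) (abs_nonneg _)
      _ ≤ ∑ j ∈ Finset.range (n + 1), |P.coeff j| * B ^ N :=
          Finset.sum_le_sum_of_subset_of_nonneg (Finset.range_subset_range.2 (by omega))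
            fun _ _ _ => by positivity
      _ = B ^ (N + 1) := by rw [← Finset.sum_mul, pow_succ']

/-! ### Iteration of the Volterra system. -/

/-- Iterating a triangular system of Volterra type. -/
theorem volterra_iterate (P : Polynomial ℝ) (J : ℕ → ℕ → ℝ) (τ : ℕ → ℝ) (n : ℕ)
    (h : ∀ N, ∀ m ≤ n, J N m = (if m = 0 then τ N else 0) +
      ∑ ij ∈ Finset.HasAntidiagonal.antidiagonal m, P.coeff ij.1 * J (N + 1) ij.2) (N : ℕ) :
    J 0 n = ∑ k ∈ Finset.range N, (P ^ k).coeff n * τ k +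
      ∑ ij ∈ Finset.HasAntidiagonal.antidiagonal n, (P ^ N).coeff ij.1 * J N ij.2 := by
  induction N with
  | zero =>
    rw [Finset.sum_range_zero, zero_add, Finset.sum_eq_single (0, n)]
    · simp
    · rintro ⟨i, j⟩ hij hne
      have hi : i ≠ 0 := by
        rintro rfl
        simp_all
      simp [Polynomial.coeff_one, hi]
    · simp
  | succ N ih =>
    rw [ih, Finset.sum_range_succ, add_assoc]
    congr 1
    have h1 : ∀ ij ∈ Finset.HasAntidiagonal.antidiagonal n, (P ^ N).coeff ij.1 * J N ij.2 =
        (P ^ N).coeff ij.1 * (if ij.2 = 0 then τ N else 0) +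
        ∑ kl ∈ Finset.HasAntidiagonal.antidiagonal ij.2,
          (P ^ N).coeff ij.1 * (P.coeff kl.1 * J (N + 1) kl.2) := by
      intro ij hij
      rw [h N ij.2 (Finset.HasAntidiagonal.antidiagonal.snd_le hij), mul_add, Finset.mul_sum]
    rw [Finset.sum_congr rfl h1, Finset.sum_add_distrib]
    congr 1
    · rw [Finset.sum_eq_single (n, 0)]
      · simp
      · rintro ⟨i, j⟩ hij hne
        have hj : j ≠ 0 := by
          rintro rfl
          simp_all
        simp [hj]
      · simp
    -- Regrouping the double convolution is associativity of the power series product P^N · P · ∑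
    -- J(N+1, m) X^m.
    · have h2 := congrArg (PowerSeries.coeff n) (mul_assoc ((P ^ N : Polynomial ℝ) : PowerSeries ℝ)
        (P : PowerSeries ℝ) (PowerSeries.mk (J (N + 1))))
      rw [← Polynomial.coe_mul, ← pow_succ, PowerSeries.coeff_mul, PowerSeries.coeff_mul] at h2
      simp only [PowerSeries.coeff_mul, Polynomial.coeff_coe, PowerSeries.coeff_mk,
        Finset.mul_sum] at h2
      exact h2.symm

theorem tendsto_volterra (P : Polynomial ℝ) (J : ℕ → ℕ → ℝ) {β T : ℝ} (hβ : 0 < β) (hT : 0 ≤ T)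
    (n : ℕ)
    (h : ∀ N, ∀ m ≤ n, J N m = (if m = 0 then T ^ N / Real.Gamma (N * β + 1) else 0) +
      ∑ ij ∈ Finset.HasAntidiagonal.antidiagonal m, P.coeff ij.1 * J (N + 1) ij.2)
    (hJ : ∀ N m, |J N m| ≤ T ^ N / Real.Gamma (N * β + 1)) :
    Filter.Tendsto (fun N => ∑ k ∈ Finset.range N,
      (P ^ k).coeff n * (T ^ k / Real.Gamma (k * β + 1))) Filter.atTop (nhds (J 0 n)) := by
  set B := ∑ j ∈ Finset.range (n + 1), |P.coeff j| with hB
  have hB0 : 0 ≤ B := Finset.sum_nonneg fun _ _ => abs_nonneg _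
  have hlim := ((summable_pow_div_Gamma hβ (mul_nonneg hB0 hT)).tendsto_atTop_zero).const_mul
    ((n : ℝ) + 1)
  rw [mul_zero] at hlim
  rw [tendsto_iff_dist_tendsto_zero]
  refine squeeze_zero (fun _ => dist_nonneg) (fun N => ?_) hlim
  rw [dist_comm, Real.dist_eq,
    volterra_iterate P J (fun k => T ^ k / Real.Gamma (k * β + 1)) n h N, add_sub_cancel_left]
  refine (Finset.abs_sum_le_sum_abs _ _).trans ?_
  calc ∑ ij ∈ Finset.HasAntidiagonal.antidiagonal n, |(P ^ N).coeff ij.1 * J N ij.2|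
      ≤ ∑ ij ∈ Finset.HasAntidiagonal.antidiagonal n, (B * T) ^ N / Real.Gamma (N * β + 1) := by
        refine Finset.sum_le_sum fun ij hij => ?_
        rw [abs_mul, mul_pow, mul_div_assoc]
        exact mul_le_mul (abs_coeff_pow_le P n N (Finset.HasAntidiagonal.antidiagonal.fst_le hij))
          (hJ _ _) (abs_nonneg _) (by positivity)
    _ = _ := by
        rw [Finset.sum_const, Finset.Nat.card_antidiagonal, nsmul_eq_mul]
        push_cast
        rfl

/-! ### Resummation into Mittag-Leffler functions. -/

/-- Terms with k < z vanish; for k = j + z, the binomial coefficient is Γ(j+z+1)/(j! Γ(z+1)), the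
coefficient in the three-parameter series. -/
theorem hasSum_mittagLeffler3 {β l T : ℝ} (hβ : 0 < β) (hT : 0 ≤ T) (z : ℕ) :
    HasSum (fun k : ℕ => (k.choose z : ℝ) * l ^ (k - z) * (T ^ k / Real.Gamma (k * β + 1)))
      (T ^ z * mittagLeffler3 β (z * β + 1) (z + 1) (l * T)) := by
  have hΓ (k : ℕ) : 0 < Real.Gamma (k * β + 1) := Real.Gamma_pos_of_pos (by positivity)
  set f : ℕ → ℝ := fun k =>
    (k.choose z : ℝ) * l ^ (k - z) * (T ^ k / Real.Gamma (k * β + 1)) with hf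
  have hsum : Summable f := by
    refine Summable.of_norm_bounded (summable_pow_div_Gamma hβ
      (C := 2 * (1 + |l|) * T) (by positivity)) fun k => ?_
    have hΓk := hΓ k
    have h1 : (k.choose z : ℝ) ≤ 2 ^ k := by exact_mod_cast Nat.choose_le_two_pow k z
    have h2 : |l| ^ (k - z) ≤ (1 + |l|) ^ k :=
      (pow_le_pow_left₀ (abs_nonneg l) (by linarith) _).trans
        (pow_le_pow_right₀ (by linarith [abs_nonneg l]) (Nat.sub_le k z))
    have h3 : 0 ≤ T ^ k / Real.Gamma (k * β + 1) := by positivity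
    rw [hf, norm_mul, norm_mul, norm_pow, Real.norm_of_nonneg h3, Real.norm_eq_abs l,
      Real.norm_of_nonneg (Nat.cast_nonneg _), mul_pow, mul_pow, mul_div_assoc]
    gcongr
  have key : ∑' k, f k = T ^ z * mittagLeffler3 β (z * β + 1) (z + 1) (l * T) := by
    rw [← hsum.sum_add_tsum_nat_add z, Finset.sum_eq_zero, zero_add, mittagLeffler3, ← tsum_mul_left,
      ← tsum_mul_left]
    · refine tsum_congr fun j => ?_
      have e1 : (j : ℝ) + ((z : ℝ) + 1) = ((j + z : ℕ) : ℝ) + 1 := by push_cast; ring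
      have e2 : (j : ℝ) * β + (z * β + 1) = ((j + z : ℕ) : ℝ) * β + 1 := by push_cast; ring
      have e3 := Nat.add_choose_mul_factorial_mul_factorial j z
      have e4 : ((j + z).choose z : ℝ) * (j ! : ℝ) * (z ! : ℝ) = ((j + z)! : ℝ) := by
        exact_mod_cast e3
      have := hΓ (j + z)
      rw [e1, e2, Real.Gamma_nat_eq_factorial, Real.Gamma_nat_eq_factorial, ← e4, hf]
      simp only [Nat.add_sub_cancel]
      rw [pow_add, mul_pow]
      field_simp
    · intro k hk
      rw [hf]
      simp [Nat.choose_eq_zero_of_lt (Finset.mem_range.1 hk)]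
  rw [← key]
  exact hsum.hasSum

/-! ### The fractional Poisson-logarithmic process. -/

theorem sum_antidiagonal_eq_sum_Icc (p q : ℕ → ℝ) (m : ℕ) :
    ∑ ij ∈ Finset.HasAntidiagonal.antidiagonal m, p ij.1 * q ij.2 =
      p 0 * q m + ∑ j ∈ Finset.Icc 1 m, p j * q (m - j) := by
  rw [Finset.Nat.sum_antidiagonal_eq_sum_range_succ_mk, Finset.range_eq_Ico,
    Finset.sum_eq_sum_Ico_succ_bot (Nat.succ_pos m)]
  rfl

/-- The rate of jumps of size `j + 1` in the governing system. -/
noncomputable def jumpRate (lam p : ℝ) (j : ℕ) : ℝ :=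
  -lam / Real.log p * ((1 - p) ^ (j + 1) / ((j + 1 : ℕ) : ℝ))

section FracPoissonLog

variable {Ω : Type*} [MeasurableSpace Ω] {μ : Measure Ω} {β lam p : ℝ} {M : ℝ≥0 → Ω → ℕ}

theorem abs_stateProb_le_one [IsProbabilityMeasure μ] (n : ℕ) (t : ℝ) :
    |stateProb μ M n t| ≤ 1 := by
  rw [stateProb, abs_of_nonneg measureReal_nonneg]
  exact measureReal_le_one

theorem IsFracPoissonLog.absolutelyContinuousOnInterval (hM : IsFracPoissonLog μ β lam p M)
    (n : ℕ) {t : ℝ} (ht : 0 ≤ t) : AbsolutelyContinuousOnInterval (stateProb μ M n) 0 t := by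
  refine (hM.absCont n (t + 1) (by linarith)).mono ?_
  rw [Set.uIcc_of_le ht, Set.uIcc_of_le (by linarith)]
  exact Set.Icc_subset_Icc_right (by linarith)

/-- The governing system, written with the coefficients of a generating polynomial. -/
theorem IsFracPoissonLog.caputoDeriv_eq (hM : IsFracPoissonLog μ β lam p M) {n m : ℕ}
    (hm : m ≤ n) {t : ℝ} :
    ∀ᵐ s ∂(volume.restrict (Set.Ioc 0 t)), caputoDeriv β (stateProb μ M m) s =
      ∑ ij ∈ Finset.HasAntidiagonal.antidiagonal m,
        (generatingPoly (-lam) (jumpRate lam p) n).coeff ij.1 * stateProb μ M ij.2 s := by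
  have hmono : volume.restrict (Set.Ioc 0 t) ≤ volume.restrict (Set.Ioi (0 : ℝ)) :=
    Measure.restrict_mono Set.Ioc_subset_Ioi_self le_rfl
  set P := generatingPoly (-lam) (jumpRate lam p) n with hP
  have hP0 : P.coeff 0 = -lam := by
    rw [hP, coeff_generatingPoly _ _ (Nat.zero_le n), if_pos rfl]
  rcases m.eq_zero_or_pos with rfl | hm0
  · filter_upwards [ae_mono hmono hM.eqn_zero] with s hs
    rw [hs]
    simp [hP0]
  · filter_upwards [ae_mono hmono (hM.eqn_pos m hm0)] with s hs
    rw [hs, sum_antidiagonal_eq_sum_Icc P.coeff (fun j => stateProb μ M j s), hP0, sub_eq_add_neg,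
      ← neg_mul, ← neg_div, Finset.mul_sum]
    congr 1
    refine Finset.sum_congr rfl fun j hj => ?_
    obtain ⟨h1, h2⟩ := Finset.mem_Icc.1 hj
    rw [hP, coeff_generatingPoly _ _ (h2.trans hm), if_neg (by omega), jumpRate]
    simp only [Nat.sub_add_cancel h1]
    ring

/-- Apply I^((N+1)β) to the governing equation: the Caputo derivative absorbs β of the order,
leaving I^(Nβ) q_m minus the contribution of the initial value, which is nonzero only for m = 0. -/
theorem IsFracPoissonLog.volterra (hM : IsFracPoissonLog μ β lam p M) (hβ0 : 0 < β) (hβ1 : β ≤ 1)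
    {n m : ℕ} (hm : m ≤ n) {t : ℝ} (ht : 0 ≤ t)
    {J : ℕ → ℕ → ℝ} (hJ0 : ∀ m, J 0 m = stateProb μ M m t)
    (hJ : ∀ N m, J (N + 1) m = riemannLiouville ((N + 1 : ℕ) * β) (stateProb μ M m) t) (N : ℕ) :
    J N m = (if m = 0 then (t ^ β) ^ N / Real.Gamma (N * β + 1) else 0) +
      ∑ ij ∈ Finset.HasAntidiagonal.antidiagonal m,
        (generatingPoly (-lam) (jumpRate lam p) n).coeff ij.1 * J (N + 1) ij.2 := by
  have hinit : stateProb μ M m 0 = if m = 0 then 1 else 0 := by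
    split_ifs with h
    · rw [h, hM.init_zero]
    · exact hM.init_pos m (Nat.one_le_iff_ne_zero.2 h)
  have hac := hM.absolutelyContinuousOnInterval m ht
  have hrhs : riemannLiouville ((N + 1 : ℕ) * β) (caputoDeriv β (stateProb μ M m)) t =
      ∑ ij ∈ Finset.HasAntidiagonal.antidiagonal m,
        (generatingPoly (-lam) (jumpRate lam p) n).coeff ij.1 * J (N + 1) ij.2 := by
    rw [riemannLiouville_congr_ae ht (hM.caputoDeriv_eq hm),
      riemannLiouville_sum _
        (fun ij : ℕ × ℕ => (generatingPoly (-lam) (jumpRate lam p) n).coeff ij.1)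
        (fun ij => stateProb μ M ij.2)
        (by positivity) ht fun ij _ => by
          simpa [Set.uIcc_of_le ht] using
            (hM.absolutelyContinuousOnInterval ij.2 ht).continuousOn]
    simp_rw [hJ]
  rw [← hrhs]
  rcases N with _ | N
  · rw [Nat.zero_add, Nat.cast_one, one_mul, riemannLiouville_caputoDeriv hβ0 hβ1 ht hac, hinit,
      hJ0]
    simp
  · have hb : 0 < ((N + 1 : ℕ) : ℝ) * β := by positivity
    rw [show ((N + 1 + 1 : ℕ) : ℝ) * β = ((N + 1 : ℕ) : ℝ) * β + β by push_cast; ring,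
      riemannLiouville_add_caputoDeriv hβ0 hβ1 hb ht hac, hinit, hJ, ← Real.rpow_natCast,
      ← Real.rpow_mul ht, mul_comm β]
    split_ifs <;> ring

theorem IsFracPoissonLog.stateProb_eq [IsProbabilityMeasure μ] (hM : IsFracPoissonLog μ β lam p M)
    (hβ0 : 0 < β) (hβ1 : β ≤ 1) {t : ℝ} (ht : 0 ≤ t) (n : ℕ) :
    stateProb μ M n t =
      ∑ x ∈ weightedTuples n,
        (∏ j : Fin n, ((1 - p) ^ ((j : ℕ) + 1) / (((j : ℕ) + 1 : ℕ) : ℝ)) ^ x j /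
          ((x j)! : ℝ)) *
        ((∑ j, x j)! : ℝ) *
        (-lam * t ^ β / Real.log p) ^ (∑ j, x j) *
        mittagLeffler3 β (((∑ j, x j : ℕ) : ℝ) * β + 1) (((∑ j, x j : ℕ) : ℝ) + 1)
          (-lam * t ^ β) := by
  set P : Polynomial ℝ := generatingPoly (-lam) (jumpRate lam p) n with hP
  -- N = 0 is set apart because `riemannLiouville 0` is not the identity: `Real.Gamma 0 = 0` makes
  -- it vanish.
  set J : ℕ → ℕ → ℝ := fun N m =>
    if N = 0 then stateProb μ M m t else riemannLiouville (N * β) (stateProb μ M m) t with hJ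
  have hT : 0 ≤ t ^ β := Real.rpow_nonneg ht β
  have hlim := tendsto_volterra P J hβ0 hT n
    (fun N m hm => hM.volterra hβ0 hβ1 hm ht (fun m => by simp [hJ]) (fun N m => by simp [hJ]) N)
    (fun N m => by
      rcases N with _ | N
      · simpa [hJ] using abs_stateProb_le_one m t
      · have := abs_riemannLiouville_le (a := ((N + 1 : ℕ) : ℝ) * β) (by positivity) ht
          (abs_stateProb_le_one (μ := μ) (M := M) m)
        rw [mul_comm _ β, Real.rpow_mul ht, Real.rpow_natCast, mul_comm β] at this
        simpa only [hJ, Nat.succ_ne_zero, if_false] using this)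
  have hsum := hasSum_sum (s := weightedTuples n) fun x _ =>
    (hasSum_mittagLeffler3 (l := -lam) hβ0 hT (∑ j, x j)).mul_left
      ((∏ j : Fin n, jumpRate lam p j ^ x j / ((x j)! : ℝ)) * ((∑ j, x j)! : ℝ))
  have hcoeff (k : ℕ) := congrArg (· * ((t ^ β) ^ k / Real.Gamma (k * β + 1)))
    (coeff_pow_eq_sum_weightedTuples (-lam) (jumpRate lam p) n k)
  simp only [Finset.sum_mul, mul_assoc] at hcoeff hsum
  simp only [hP, hcoeff] at hlim
  have hJn : J 0 n = stateProb μ M n t := by simp [hJ]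
  rw [← hJn, tendsto_nhds_unique hlim hsum.tendsto_sum_nat]
  refine Finset.sum_congr rfl fun x _ => ?_
  -- The common factor -λ / ln p of the rates is pulled out of the product, to the power ∑ x_j, and
  -- merges with t^β.
  simp_rw [jumpRate, mul_pow (-lam / Real.log p), mul_div_assoc]
  rw [Finset.prod_mul_distrib, Finset.prod_pow_eq_pow_sum, ← mul_div_assoc,
    mul_div_right_comm (-lam), mul_pow]
  ring

end FracPoissonLog

theorem mainTheorem5 {Ω : Type*} [MeasurableSpace Ω] (μ : Measure Ω) [IsProbabilityMeasure μ]
    (β lam p : ℝ) (hβ0 : 0 < β) (hβ1 : β ≤ 1) (hlam : 0 < lam) (hp0 : 0 < p) (hp1 : p < 1)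
    (M : ℝ≥0 → Ω → ℕ) (hM : IsFracPoissonLog μ β lam p M) (t : ℝ) (ht : 0 ≤ t) :
    stateProb μ M 0 t = mittagLeffler2 β 1 (-lam * t ^ β) ∧
    ∀ n : ℕ, 1 ≤ n →
      stateProb μ M n t =
        ∑ x ∈ weightedTuples n,
          (∏ j : Fin n, ((1 - p) ^ ((j : ℕ) + 1) / (((j : ℕ) + 1 : ℕ) : ℝ)) ^ x j /
            ((x j)! : ℝ)) *
          ((∑ j, x j)! : ℝ) *
          (-lam * t ^ β / Real.log p) ^ (∑ j, x j) *
          mittagLeffler3 β (((∑ j, x j : ℕ) : ℝ) * β + 1) (((∑ j, x j : ℕ) : ℝ) + 1)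
            (-lam * t ^ β) := by
  refine ⟨?_, fun n _ => hM.stateProb_eq hβ0 hβ1 ht n⟩
  -- For n = 0 only the empty tuple remains, and the general formula reduces to E_{β,1}.
  have h : weightedTuples 0 = Finset.univ := by
    ext x
    simp only [mem_weightedTuples, Finset.univ_eq_empty, Finset.sum_empty, Finset.mem_univ]
  rw [hM.stateProb_eq hβ0 hβ1 ht 0, h]
  simp [mittagLeffler2]
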